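/- There is an absolute constant $C_3$ with $0 < C_3 < 1 - 1.3\cdot 10^{-12}$ such that, with $\nu := -\log_3 C_3$ (so that $\nu > 1.19\cdot 10^{-12} > 0$), the following hold. Throughout, $p$ denotes a prime, $0<\lambda\le \frac{9}{10}$ is real, and $Y = Y_1+\dots+Y_\ell$ denotes a sum of $\ell$ independent and identically distributed $\mathbb{Z}_p$-valued random variables with $\mathbb{P}[Y_1 = x]\le\lambda$ for every $x\in\mathbb{Z}_p$. (0) If $\ell = 3$ and $p > \frac{2}{\lambda}$, then $\max_{x\in\mathbb{Z}_p}\mathbb{P}[Y=x]\le C_3\lambda$. (1) For every $\epsilon>0$ there is an $L$, depending only on $\epsilon$, such that for all $\ell\ge L$, all $\lambda$ and all $p > \frac{2}{\lambda\epsilon}$, $$\max_{x\in\mathbb{Z}_p}\mathbb{P}[Y=x]\le\epsilon\lambda.$$ (2) In particular, if $\epsilon>0$, if $k_0$ is a positive integer with $C_3^{k_0}<\epsilon\le C_3^{k_0-1}$, and if $\ell_0 = 3^{k_0}$, then $\max_{x\in\mathbb{Z}_p}\mathbb{P}[Y=x]\le\epsilon\lambda$ for all $\ell\ge\ell_0$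 and all $p>\frac{2}{\lambda\epsilon}$. (3) If $\ell_0$ is a power of $3$, $\ell\ge\ell_0$ and $p>\frac{2}{\lambda}\left(\frac{\ell_0}{3}\right)^{\nu}$, then $$\max_{x\in\mathbb{Z}_p}\mathbb{P}[Y=x]\le\lambda\left(\frac{3}{\ell_0}\right)^{\nu}.$$ -/

import Mathlib

open MeasureTheory ProbabilityTheory

/-- The random variables `Y 0, …, Y (ℓ - 1)` with values in `ZMod p` are independent and
identically distributed under `μ`, and every point probability `μ (Y i = x)` is at most `lam`. -/
structure IsIIDBoundedBy {Ω : Type*} [MeasurableSpace Ω] (μ : Measure Ω) {p ℓ : ℕ}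
    (Y : Fin ℓ → Ω → ZMod p) (lam : ℝ) : Prop where
  indep : iIndepFun Y μ
  identDistrib : ∀ i j, IdentDistrib (Y i) (Y j) μ μ
  bound : ∀ i, ∀ x : ZMod p, μ.real {ω | Y i ω = x} ≤ lam

/-- Every point probability of the sum `Y 0 + ⋯ + Y (ℓ - 1)` is at most `b`; since `ZMod p` is
finite for `p ≠ 0`, this says that the largest of them is at most `b`. -/
def SumBoundedBy {Ω : Type*} [MeasurableSpace Ω] (μ : Measure Ω) {p ℓ : ℕ}
    (Y : Fin ℓ → Ω → ZMod p) (b : ℝ) : Prop :=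
  ∀ x : ZMod p, μ.real {ω | ∑ i, Y i ω = x} ≤ b

/-! Let `f` be the law of one variable. If `f * f * f` came within 1% of `lam` at `x`, most of the
mass of `f` would lie on a set `G` of shifts `a` for which `(f * f) (x - a)` is nearly `lam`. Two
such shifts make the autocorrelation of `f` at their difference large (`autocorrelation_ge`). The
autocorrelation has total mass 1, so `G - G` would be small, while Cauchy–Davenport makes it almost
twice as large as `G`. Hence `C₃ = 99 / 100` works (`cyclicConv_self_self_le`). Each tripling
repeats the gain with `lam` replaced by the improved bound, and further summands only average. -/

/-- The convolution of two real functions on `ZMod p`. -/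
noncomputable def cyclicConv {p : ℕ} [NeZero p] (f g : ZMod p → ℝ) (x : ZMod p) : ℝ :=
  ∑ a, f a * g (x - a)

/-- The `n`-fold convolution power of a real function on `ZMod p`. -/
noncomputable def cyclicConvPow {p : ℕ} [NeZero p] (f : ZMod p → ℝ) : ℕ → ZMod p → ℝ
  | 0 => Pi.single 0 1
  | n + 1 => cyclicConv f (cyclicConvPow f n)

/-! ### Convolution powers on `ZMod p` and the gain from tripling -/

section Convolution

variable {p : ℕ} [NeZero p]

theorem sum_comp_sub_right (f : ZMod p → ℝ) (a : ZMod p) : ∑ x, f (x - a) = ∑ x, f x :=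
  (Equiv.subRight a).sum_comp f

theorem sum_comp_sub_left (f : ZMod p → ℝ) (a : ZMod p) : ∑ x, f (a - x) = ∑ x, f x :=
  (Equiv.subLeft a).sum_comp f

theorem cyclicConv_assoc (f g h : ZMod p → ℝ) :
    cyclicConv (cyclicConv f g) h = cyclicConv f (cyclicConv g h) := by
  funext x
  simp only [cyclicConv, Finset.sum_mul, Finset.mul_sum]
  rw [Finset.sum_comm]
  refine Finset.sum_congr rfl fun b _ => ?_
  rw [← sum_comp_sub_right (fun a => f b * (g a * h (x - b - a))) b]
  refine Finset.sum_congr rfl fun a _ => ?_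
  rw [show x - b - (a - b) = x - a by abel, mul_assoc]

theorem single_cyclicConv (f : ZMod p → ℝ) : cyclicConv (Pi.single 0 1) f = f := by
  funext x
  simp [cyclicConv, Pi.single_apply]

theorem cyclicConv_single (f : ZMod p → ℝ) : cyclicConv f (Pi.single 0 1) = f := by
  funext x
  simp [cyclicConv, Pi.single_apply, sub_eq_zero]

theorem cyclicConv_nonneg {f g : ZMod p → ℝ} (hf : ∀ x, 0 ≤ f x) (hg : ∀ x, 0 ≤ g x)
    (x : ZMod p) : 0 ≤ cyclicConv f g x :=
  Finset.sum_nonneg fun _ _ => mul_nonneg (hf _) (hg _)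

theorem cyclicConv_le {f g : ZMod p → ℝ} {c : ℝ} (hf : ∀ x, 0 ≤ f x) (hf1 : ∑ x, f x = 1)
    (hg : ∀ x, g x ≤ c) (x : ZMod p) : cyclicConv f g x ≤ c :=
  calc cyclicConv f g x ≤ ∑ a, f a * c :=
        Finset.sum_le_sum fun a _ => mul_le_mul_of_nonneg_left (hg _) (hf a)
    _ = c := by rw [← Finset.sum_mul, hf1, one_mul]

theorem sum_cyclicConv (f g : ZMod p → ℝ) :
    ∑ x, cyclicConv f g x = (∑ x, f x) * ∑ x, g x := by
  simp only [cyclicConv]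
  rw [Finset.sum_comm, Finset.sum_mul]
  refine Finset.sum_congr rfl fun a _ => ?_
  rw [← Finset.mul_sum, sum_comp_sub_right]

theorem cyclicConvPow_one (f : ZMod p → ℝ) : cyclicConvPow f 1 = f :=
  cyclicConv_single f

theorem cyclicConvPow_add (f : ZMod p → ℝ) (m n : ℕ) :
    cyclicConvPow f (m + n) = cyclicConv (cyclicConvPow f m) (cyclicConvPow f n) := by
  induction m with
  | zero => rw [Nat.zero_add, cyclicConvPow, single_cyclicConv]
  | succ m ih =>
    rw [Nat.succ_add, cyclicConvPow, ih, cyclicConvPow, cyclicConv_assoc]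

theorem cyclicConvPow_nonneg {f : ZMod p → ℝ} (hf : ∀ x, 0 ≤ f x) (n : ℕ) (x : ZMod p) :
    0 ≤ cyclicConvPow f n x := by
  induction n generalizing x with
  | zero =>
    rw [cyclicConvPow, Pi.single_apply]
    split_ifs <;> norm_num
  | succ n ih => exact cyclicConv_nonneg hf ih x

theorem sum_cyclicConvPow {f : ZMod p → ℝ} (hf1 : ∑ x, f x = 1) (n : ℕ) :
    ∑ x, cyclicConvPow f n x = 1 := by
  induction n with
  | zero => simp [cyclicConvPow]
  | succ n ih => rw [cyclicConvPow, sum_cyclicConv, hf1, ih, one_mul]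

/-- The additional factors form a probability density, and averaging cannot raise a maximum. -/
theorem cyclicConvPow_le_of_le {f : ZMod p → ℝ} {c : ℝ} {m n : ℕ} (hf : ∀ x, 0 ≤ f x)
    (hf1 : ∑ x, f x = 1) (hmn : m ≤ n) (h : ∀ x, cyclicConvPow f m x ≤ c) (x : ZMod p) :
    cyclicConvPow f n x ≤ c := by
  obtain ⟨k, rfl⟩ := Nat.exists_eq_add_of_le' hmn
  rw [cyclicConvPow_add]
  exact cyclicConv_le (cyclicConvPow_nonneg hf k) (sum_cyclicConvPow hf1 k) h x

/-- If two translates of `f` both correlate well with one reflected translate of `f`, then they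
correlate well with each other. -/
theorem autocorrelation_ge {f : ZMod p → ℝ} {lam η : ℝ} (hlam : 0 < lam) (hf : ∀ x, 0 ≤ f x)
    (hfl : ∀ x, f x ≤ lam) (hf1 : ∑ x, f x = 1) (x a a' : ZMod p)
    (ha : (1 - η) * lam ≤ ∑ b, f b * f (x - a - b))
    (ha' : (1 - η) * lam ≤ ∑ b, f b * f (x - a' - b)) :
    (1 - 2 * η) * lam ≤ ∑ y, f y * f (y + (a - a')) := by
  have shift : ∀ c : ZMod p, ∑ b, f b * f (x - c - b) = ∑ y, f (y - c) * f (x - y) := fun c => by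
    rw [← sum_comp_sub_right _ c]
    refine Finset.sum_congr rfl fun y _ => ?_
    rw [show x - c - (y - c) = x - y by abel]
  have hcorr : ∑ y, f y * f (y + (a - a')) = ∑ y, f (y - a) * f (y - a') := by
    rw [← sum_comp_sub_right _ a]
    refine Finset.sum_congr rfl fun y _ => ?_
    rw [show y - a + (a - a') = y - a' by abel]
  -- After multiplication by `lam`, the difference of the two sides is `F F' (lam - r) + r (lam - F)
  -- (lam - F')`.
  have key : ∀ F F' r : ℝ, 0 ≤ F → F ≤ lam → 0 ≤ F' → F' ≤ lam → 0 ≤ r → r ≤ lam →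
      F * r + F' * r - lam * r ≤ F * F' := by
    intro F F' r h0 h1 h0' h1' hr hr'
    have e1 := mul_nonneg (mul_nonneg h0 h0') (sub_nonneg.2 hr')
    have e2 := mul_nonneg (mul_nonneg (sub_nonneg.2 h1) (sub_nonneg.2 h1')) hr
    refine le_of_mul_le_mul_left ?_ hlam
    nlinarith
  rw [shift] at ha ha'
  rw [hcorr]
  have hle : ∑ y, (f (y - a) * f (x - y) + f (y - a') * f (x - y) - lam * f (x - y)) ≤
      ∑ y, f (y - a) * f (y - a') :=
    Finset.sum_le_sum fun y _ => key _ _ _ (hf _) (hfl _) (hf _) (hfl _) (hf _) (hfl _)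
  rw [Finset.sum_sub_distrib, Finset.sum_add_distrib, ← Finset.mul_sum, sum_comp_sub_left f x,
    hf1] at hle
  linarith

open scoped Pointwise in
/-- The threefold convolution of a probability density on `ZMod p` that is bounded by `lam` is
bounded by `99 / 100 * lam`. -/
theorem cyclicConv_self_self_le (hp : p.Prime) {f : ZMod p → ℝ} {lam : ℝ} (hlam : 0 < lam)
    (hlam' : lam ≤ 9 / 10) (hplam : 2 / lam < p) (hf : ∀ x, 0 ≤ f x) (hfl : ∀ x, f x ≤ lam)
    (hf1 : ∑ x, f x = 1) (x : ZMod p) :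
    cyclicConv f (cyclicConv f f) x ≤ 99 / 100 * lam := by
  classical
  by_contra! hcon
  set r : ZMod p → ℝ := fun a => ∑ b, f b * f (x - a - b) with hr
  have hrle : ∀ a, r a ≤ lam := fun a => cyclicConv_le hf hf1 hfl (x - a)
  set G : Finset (ZMod p) := Finset.univ.filter fun a => (1 - 1 / 8) * lam ≤ r a with hG
  -- With `m` the mass of `G`, the average of `r` under `f` is at most `(m + 7/8 (1 - m)) lam`;
  -- exceeding `0.99 lam` forces `m > 0.92`.
  have hGmass : 92 / 100 < ∑ a ∈ G, f a := by
    have hsplit := Finset.sum_filter_add_sum_filter_not Finset.univ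
      (fun a => (1 - 1 / 8) * lam ≤ r a) f
    have hle : ∑ a, f a * r a ≤
        (∑ a ∈ G, f a) * lam + (1 - ∑ a ∈ G, f a) * ((1 - 1 / 8) * lam) := by
      rw [← Finset.sum_filter_add_sum_filter_not Finset.univ
        (fun a => (1 - 1 / 8) * lam ≤ r a) fun a => f a * r a, ← eq_sub_of_add_eq' (hsplit.trans hf1),
        Finset.sum_mul, Finset.sum_mul]
      refine add_le_add (Finset.sum_le_sum fun a _ => ?_) (Finset.sum_le_sum fun a ha => ?_)
      · exact mul_le_mul_of_nonneg_left (hrle a) (hf a)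
      · exact mul_le_mul_of_nonneg_left (not_le.1 (Finset.mem_filter.1 ha).2).le (hf a)
    have h2 : 99 / 100 * lam < ∑ a, f a * r a := hcon
    nlinarith
  have hGcard : 92 / 100 < (G.card : ℝ) * lam :=
    calc 92 / 100 < ∑ a ∈ G, f a := hGmass
      _ ≤ ∑ _a ∈ G, lam := Finset.sum_le_sum fun a _ => hfl a
      _ = G.card * lam := by rw [Finset.sum_const, nsmul_eq_mul]
  -- A single point would carry mass at most `lam ≤ 0.9 < 0.92`.
  have hG2 : 2 ≤ G.card := by
    by_contra! h
    have h1 : (G.card : ℝ) ≤ 1 := by exact_mod_cast Nat.lt_succ_iff.1 h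
    nlinarith
  have hGne : G.Nonempty := Finset.card_pos.1 (by omega)
  have hcorr : ∀ t ∈ G + -G, (1 - 2 * (1 / 8)) * lam ≤ ∑ y, f y * f (y + t) := by
    intro t ht
    obtain ⟨a, ha, b, hb, rfl⟩ := Finset.mem_add.1 ht
    have hb' := Finset.mem_neg'.1 hb
    have := autocorrelation_ge hlam hf hfl hf1 x a (-b) (Finset.mem_filter.1 ha).2
      (Finset.mem_filter.1 hb').2
    rwa [sub_neg_eq_add] at this
  have htotal : ∑ t, ∑ y, f y * f (y + t) = 1 := by
    rw [Finset.sum_comm]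
    simp only [← Finset.mul_sum]
    have : ∀ y, ∑ t, f (y + t) = 1 := fun y => hf1 ▸ Equiv.sum_comp (Equiv.addLeft y) f
    simp only [this, mul_one, hf1]
  have hD : ((G + -G).card : ℝ) * ((1 - 2 * (1 / 8)) * lam) ≤ 1 :=
    calc ((G + -G).card : ℝ) * ((1 - 2 * (1 / 8)) * lam)
        = ∑ _t ∈ G + -G, (1 - 2 * (1 / 8)) * lam := by rw [Finset.sum_const, nsmul_eq_mul]
      _ ≤ ∑ t ∈ G + -G, ∑ y, f y * f (y + t) := Finset.sum_le_sum hcorr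
      _ ≤ ∑ t, ∑ y, f y * f (y + t) :=
        Finset.sum_le_sum_of_subset_of_nonneg (Finset.subset_univ _) fun t _ _ =>
          Finset.sum_nonneg fun y _ => mul_nonneg (hf _) (hf _)
      _ = 1 := htotal
  have hplam' : 2 < p * lam := (div_lt_iff₀ hlam).1 hplam
  -- If `G - G` is everything, `hD` contradicts `p * lam > 2`. Otherwise `|G - G| ≥ 2|G| - 1 ≥
  -- (3/2)|G|`, and `(3/2)(3/4)(0.92) > 1`.
  rcases min_le_iff.1 (ZMod.cauchy_davenport hp hGne hGne.neg) with h | h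
  · have h' : (p : ℝ) ≤ (G + -G).card := by exact_mod_cast h
    nlinarith
  · rw [Finset.card_neg] at h
    have h' : (2 * G.card : ℝ) ≤ (G + -G).card + 1 := by
      have : 2 * G.card ≤ (G + -G).card + 1 := by omega
      exact_mod_cast this
    have h2 : (2 : ℝ) ≤ G.card := by exact_mod_cast hG2
    have h3 : 3 / 2 * (G.card : ℝ) ≤ (G + -G).card := by linarith
    nlinarith

/-- Iterated form: the convolution power of order `3 ^ k` gains a factor `(99 / 100) ^ k`. -/
theorem cyclicConvPow_three_pow_le (hp : p.Prime) {f : ZMod p → ℝ} {lam : ℝ} (hlam : 0 < lam)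
    (hlam' : lam ≤ 9 / 10) (hf : ∀ x, 0 ≤ f x) (hfl : ∀ x, f x ≤ lam) (hf1 : ∑ x, f x = 1)
    (k : ℕ) (hplam : k ≠ 0 → 2 / (lam * (99 / 100) ^ (k - 1)) < p) (x : ZMod p) :
    cyclicConvPow f (3 ^ k) x ≤ (99 / 100) ^ k * lam := by
  induction k generalizing x with
  | zero => simpa [cyclicConvPow_one] using hfl x
  | succ k ih =>
    have hpk : 2 / (lam * (99 / 100) ^ k) < p := by simpa using hplam (Nat.succ_ne_zero k)
    have hprev : ∀ y, cyclicConvPow f (3 ^ k) y ≤ (99 / 100) ^ k * lam := by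
      -- The lower bound on `p` grows with the exponent, so the last stage covers all earlier ones.
      refine ih fun _ => lt_of_le_of_lt ?_ hpk
      refine div_le_div_of_nonneg_left (by norm_num) (by positivity)
        (mul_le_mul_of_nonneg_left ?_ hlam.le)
      exact pow_le_pow_of_le_one (a := (99 / 100 : ℝ)) (by norm_num) (by norm_num) (Nat.sub_le k 1)
    have hpow : ((99 : ℝ) / 100) ^ k ≤ 1 := pow_le_one₀ (by norm_num) (by norm_num)
    have := cyclicConv_self_self_le hp (lam := (99 / 100) ^ k * lam) (by positivity)
      (by nlinarith) (by rwa [mul_comm]) (cyclicConvPow_nonneg hf (3 ^ k)) hprev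
      (sum_cyclicConvPow hf1 _) x
    rw [show 3 ^ (k + 1) = 3 ^ k + (3 ^ k + 3 ^ k) by ring, cyclicConvPow_add, cyclicConvPow_add,
      pow_succ]
    linarith

end Convolution

/-! ### From independent random variables to convolutions -/

section Law

variable {Ω : Type*} [MeasurableSpace Ω] {μ : Measure Ω} [IsProbabilityMeasure μ] {p : ℕ}

theorem discreteMeasurableSpace_zmod (p : ℕ) : DiscreteMeasurableSpace (ZMod p) :=
  ⟨fun _ => trivial⟩

variable [NeZero p]

/-- The law of a sum of two independent variables is the convolution of their laws. -/
theorem measureReal_add_eq_cyclicConv {X Z : Ω → ZMod p} (hX : AEMeasurable X μ)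
    (hZ : AEMeasurable Z μ) (h : IndepFun X Z μ) (x : ZMod p) :
    μ.real {ω | X ω + Z ω = x} =
      cyclicConv (fun a => μ.real {ω | X ω = a}) (fun a => μ.real {ω | Z ω = a}) x := by
  have := discreteMeasurableSpace_zmod p
  have hnull : ∀ {W : Ω → ZMod p}, AEMeasurable W μ → ∀ a, NullMeasurableSet {ω | W ω = a} μ :=
    fun hW a => hW.nullMeasurableSet_preimage (measurableSet_singleton a)
  have hU : {ω | X ω + Z ω = x} =
      ⋃ a ∈ (Finset.univ : Finset (ZMod p)), {ω | X ω = a} ∩ {ω | Z ω = x - a} := by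
    ext ω
    simp [eq_sub_iff_add_eq, add_comm]
  rw [hU, measureReal_biUnion_finset₀, cyclicConv]
  · refine Finset.sum_congr rfl fun a _ => ?_
    have := h.measure_inter_preimage_eq_mul {a} {x - a} (measurableSet_singleton _)
      (measurableSet_singleton _)
    have := congrArg ENNReal.toReal this
    rwa [ENNReal.toReal_mul] at this
  · refine fun a _ b _ hab => Disjoint.aedisjoint ?_
    exact Set.disjoint_left.2 fun ω h1 h2 => hab (h1.1.symm.trans h2.1)
  · exact fun a _ => (hnull hX a).inter (hnull hZ _)

theorem sum_measureReal_eq_one {X : Ω → ZMod p} (hX : AEMeasurable X μ) :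
    ∑ a, μ.real {ω | X ω = a} = 1 := by
  have := discreteMeasurableSpace_zmod p
  rw [← measureReal_biUnion_finset₀ (s := Finset.univ) (f := fun a => {ω | X ω = a})]
  · have : (⋃ a ∈ (Finset.univ : Finset (ZMod p)), {ω | X ω = a}) = Set.univ := by
      ext ω
      simp
    rw [this, probReal_univ]
  · exact fun a _ b _ hab => Disjoint.aedisjoint
      (Set.disjoint_left.2 fun ω h1 h2 => hab (h1.symm.trans h2))
  · exact fun a _ => hX.nullMeasurableSet_preimage (measurableSet_singleton a)

theorem measureReal_finset_sum_eq_cyclicConvPow {ι : Type*} {Y : ι → Ω → ZMod p}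
    {f : ZMod p → ℝ} (hmeas : ∀ i, AEMeasurable (Y i) μ) (hind : iIndepFun Y μ)
    (hlaw : ∀ i a, μ.real {ω | Y i ω = a} = f a) (s : Finset ι) (x : ZMod p) :
    μ.real {ω | ∑ i ∈ s, Y i ω = x} = cyclicConvPow f s.card x := by
  classical
  have := discreteMeasurableSpace_zmod p
  induction s using Finset.induction_on generalizing x with
  | empty =>
    by_cases hx : x = 0
    · simp [cyclicConvPow, hx]
    · simp [cyclicConvPow, Ne.symm hx, hx]
  | insert i s hi ih =>
    simp only [Finset.sum_insert hi]
    have hI := (hind.indepFun_finsetSum_of_notMem₀ hmeas hi).symm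
    have hsm : AEMeasurable (∑ j ∈ s, Y j) μ := Finset.aemeasurable_sum s fun j _ => hmeas j
    have := measureReal_add_eq_cyclicConv (hmeas i) hsm hI x
    simp only [Finset.sum_apply, ih, hlaw] at this
    rw [this, Finset.card_insert_of_notMem hi, cyclicConvPow]

/-- A sum of at least `3 ^ k` variables has point probabilities at most `(99 / 100) ^ k * lam`. -/
theorem IsIIDBoundedBy.sumBoundedBy_pow {ℓ : ℕ} {Y : Fin ℓ → Ω → ZMod p} {lam : ℝ}
    (hY : IsIIDBoundedBy μ Y lam) (hp : p.Prime) (hlam : 0 < lam) (hlam' : lam ≤ 9 / 10) (k : ℕ)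
    (hk : 3 ^ k ≤ ℓ) (hplam : k ≠ 0 → 2 / (lam * (99 / 100) ^ (k - 1)) < p) :
    SumBoundedBy μ Y ((99 / 100) ^ k * lam) := by
  have := discreteMeasurableSpace_zmod p
  intro x
  have i₀ : Fin ℓ := ⟨0, lt_of_lt_of_le (by positivity) hk⟩
  -- Measurability is part of `IdentDistrib`, so comparing `Y i` with itself supplies it.
  have hmeas : ∀ i, AEMeasurable (Y i) μ := fun i => (hY.identDistrib i i).aemeasurable_fst
  have hlaw : ∀ i a, μ.real {ω | Y i ω = a} = μ.real {ω | Y i₀ ω = a} := fun i a =>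
    congrArg ENNReal.toReal
      ((hY.identDistrib i i₀).measure_mem_eq (measurableSet_singleton a))
  rw [measureReal_finset_sum_eq_cyclicConvPow hmeas hY.indep hlaw, Finset.card_univ,
    Fintype.card_fin]
  have hf1 := sum_measureReal_eq_one (hmeas i₀)
  exact cyclicConvPow_le_of_le (fun _ => measureReal_nonneg) hf1 hk
    (cyclicConvPow_three_pow_le hp hlam hlam' (fun _ => measureReal_nonneg) (hY.bound i₀) hf1 k
      hplam) x

end Law

/-! ### Thresholds in terms of `ε` and `ν` -/

theorem SumBoundedBy.mono {Ω : Type*} [MeasurableSpace Ω] {μ : Measure Ω} {p ℓ : ℕ}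
    {Y : Fin ℓ → Ω → ZMod p} {b c : ℝ} (h : SumBoundedBy μ Y b) (hbc : b ≤ c) :
    SumBoundedBy μ Y c :=
  fun x => (h x).trans hbc

/-- The bound `ε * lam` for sums of at least `3 ^ k` variables. -/
theorem IsIIDBoundedBy.sumBoundedBy_eps {Ω : Type*} [MeasurableSpace Ω] {μ : Measure Ω}
    [IsProbabilityMeasure μ] {p ℓ : ℕ} {Y : Fin ℓ → Ω → ZMod p} {lam ε : ℝ}
    (hY : IsIIDBoundedBy μ Y lam) (hp : p.Prime) (hlam : 0 < lam) (hlam' : lam ≤ 9 / 10)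
    (hε : 0 < ε) (k : ℕ) (hk : (99 / 100) ^ k < ε) (hk' : k ≠ 0 → ε ≤ (99 / 100) ^ (k - 1))
    (hℓ : 3 ^ k ≤ ℓ) (hplam : 2 / (lam * ε) < p) : SumBoundedBy μ Y (ε * lam) := by
  have : NeZero p := ⟨hp.ne_zero⟩
  refine (hY.sumBoundedBy_pow hp hlam hlam' k hℓ fun h => lt_of_le_of_lt ?_ hplam).mono ?_
  · have := hk' h
    gcongr
  · gcongr

/-- Since `3 ^ logb 3 c = c`, powers of 3 become powers of `c`. The form `c ^ k / c` avoids a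
truncated `k - 1` at `k = 0`. -/
theorem rpow_neg_logb_three_pow {c : ℝ} (hc : 0 < c) (k : ℕ) :
    (3 / ((3 ^ k : ℕ) : ℝ)) ^ (-Real.logb 3 c) = c ^ k / c := by
  have h3 : (3 : ℝ) ^ Real.logb 3 c = c := Real.rpow_logb (by norm_num) (by norm_num) hc
  rw [Real.rpow_neg (by positivity), Real.div_rpow (by norm_num) (by positivity), Nat.cast_pow,
    Nat.cast_ofNat, ← Real.rpow_natCast 3 k, ← Real.rpow_mul (by norm_num), mul_comm (k : ℝ),
    Real.rpow_mul (by norm_num), h3, Real.rpow_natCast, inv_div]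

theorem mainTheorem2 :
    ∃ C₃ ν : ℝ, 0 < C₃ ∧ C₃ < 1 - 1.3 * 10 ^ (-12 : ℤ) ∧
      ν = -Real.logb 3 C₃ ∧ 1.19 * 10 ^ (-12 : ℤ) < ν ∧
      -- `C₃` is a valid constant for sums of three variables
      (∀ (p : ℕ) (lam : ℝ), p.Prime → 0 < lam → lam ≤ 9 / 10 → 2 / lam < (p : ℝ) →
        ∀ (Ω : Type*) [MeasurableSpace Ω] (μ : Measure Ω) [IsProbabilityMeasure μ]
          (Y : Fin 3 → Ω → ZMod p), IsIIDBoundedBy μ Y lam → SumBoundedBy μ Y (C₃ * lam)) ∧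
      -- the bound `ε * lam` for all `ℓ` that are large in terms of `ε` alone
      (∀ ε : ℝ, 0 < ε → ∃ L : ℕ, ∀ ℓ : ℕ, L ≤ ℓ →
        ∀ (p : ℕ) (lam : ℝ), p.Prime → 0 < lam → lam ≤ 9 / 10 → 2 / (lam * ε) < (p : ℝ) →
        ∀ (Ω : Type*) [MeasurableSpace Ω] (μ : Measure Ω) [IsProbabilityMeasure μ]
          (Y : Fin ℓ → Ω → ZMod p), IsIIDBoundedBy μ Y lam → SumBoundedBy μ Y (ε * lam)) ∧
      -- the explicit threshold `ℓ₀ = 3 ^ k₀`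
      (∀ (ε : ℝ) (k₀ : ℕ), 0 < ε → 1 ≤ k₀ → C₃ ^ k₀ < ε → ε ≤ C₃ ^ (k₀ - 1) →
        ∀ ℓ : ℕ, 3 ^ k₀ ≤ ℓ →
        ∀ (p : ℕ) (lam : ℝ), p.Prime → 0 < lam → lam ≤ 9 / 10 → 2 / (lam * ε) < (p : ℝ) →
        ∀ (Ω : Type*) [MeasurableSpace Ω] (μ : Measure Ω) [IsProbabilityMeasure μ]
          (Y : Fin ℓ → Ω → ZMod p), IsIIDBoundedBy μ Y lam → SumBoundedBy μ Y (ε * lam)) ∧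
      -- the restatement in terms of `ν`
      (∀ ℓ₀ ℓ : ℕ, (∃ k : ℕ, ℓ₀ = 3 ^ k) → ℓ₀ ≤ ℓ →
        ∀ (p : ℕ) (lam : ℝ), p.Prime → 0 < lam → lam ≤ 9 / 10 →
        2 / lam * ((ℓ₀ : ℝ) / 3) ^ ν < (p : ℝ) →
        ∀ (Ω : Type*) [MeasurableSpace Ω] (μ : Measure Ω) [IsProbabilityMeasure μ]
          (Y : Fin ℓ → Ω → ZMod p), IsIIDBoundedBy μ Y lam →
            SumBoundedBy μ Y (lam * (3 / (ℓ₀ : ℝ)) ^ ν)) := by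
  have hpow : ∀ n : ℕ, (0 : ℝ) < (99 / 100) ^ n := fun n => by positivity
  refine ⟨99 / 100, -Real.logb 3 (99 / 100), by norm_num, by norm_num, rfl, ?_, ?_, ?_, ?_, ?_⟩
  · have h1 : Real.log (99 / 100) ≤ 99 / 100 - 1 := Real.log_le_sub_one_of_pos (by norm_num)
    have h2 : Real.log 3 ≤ 3 - 1 := Real.log_le_sub_one_of_pos (by norm_num)
    have h3 : 0 < Real.log 3 := Real.log_pos (by norm_num)
    rw [Real.logb, ← neg_div, lt_div_iff₀ h3]
    norm_num
    linarith
  · intro p lam hp hlam hlam' hplam Ω _ μ _ Y hY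
    have : NeZero p := ⟨hp.ne_zero⟩
    simpa using hY.sumBoundedBy_pow hp hlam hlam' 1 (by norm_num) (by simpa using hplam)
  · intro ε hε
    have hex : ∃ k : ℕ, ((99 : ℝ) / 100) ^ k < ε := exists_pow_lt_of_lt_one hε (by norm_num)
    classical
    -- Minimality of the exponent gives `ε ≤ (99 / 100) ^ (k - 1)` when `k ≠ 0`; `k = 0` occurs for
    -- `ε > 1`.
    refine ⟨3 ^ Nat.find hex, fun ℓ hℓ p lam hp hlam hlam' hplam Ω _ μ _ Y hY => ?_⟩
    refine hY.sumBoundedBy_eps hp hlam hlam' hε _ (Nat.find_spec hex) (fun h => ?_) hℓ hplam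
    exact not_lt.1 (Nat.find_min hex (Nat.sub_lt (Nat.pos_of_ne_zero h) one_pos))
  · intro ε k₀ hε _ hlt hle ℓ hℓ p lam hp hlam hlam' hplam Ω _ μ _ Y hY
    exact hY.sumBoundedBy_eps hp hlam hlam' hε k₀ hlt (fun _ => hle) hℓ hplam
  · rintro _ ℓ ⟨k, rfl⟩ hℓ p lam hp hlam hlam' hplam Ω _ μ _ Y hY
    have : NeZero p := ⟨hp.ne_zero⟩
    have hc := rpow_neg_logb_three_pow (c := 99 / 100) (by norm_num) k
    have hk := hpow k
    rw [hc]
    refine (hY.sumBoundedBy_pow hp hlam hlam' k hℓ fun h => ?_).mono ?_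
    · rw [← inv_div 3, Real.inv_rpow (by positivity), hc, ← div_eq_mul_inv, div_div] at hplam
      obtain ⟨j, rfl⟩ := Nat.exists_eq_succ_of_ne_zero h
      simpa [pow_succ] using hplam
    -- The claim only needs exponent `k - 1`, so a factor `99 / 100` is to spare.
    · rw [mul_comm]
      gcongr
      rw [le_div_iff₀ (by norm_num)]
      linarith
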